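/- Let $n\ge 1$, let $a_1,\dots,a_{n-1},b_1,\dots,b_{n-1}\ge 2$ be integers, and let $$G=\langle x_1,\dots,x_n \mid x_1^{a_1}=x_2^{b_1},\ x_2^{a_2}=x_3^{b_2},\ \dots,\ x_{n-1}^{a_{n-1}}=x_n^{b_{n-1}}\rangle .$$ Then the full group $C^*$-algebra $C^*(G)$ (the completion of the group algebra $\mathbb{C}[G]$ in the norm $\|f\|=\sup_\pi\|\pi(f)\|$, where $\pi$ runs through the unitary representations of the discrete group $G$ on complex Hilbert spaces) is residually finite-dimensional: for every nonzero $c\in C^*(G)$ there is a $*$-homomorphism $\varphi$ from $C^*(G)$ to the bounded operators on a finite-dimensional Hilbert space with $\varphi(c)\neq 0$. -/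

import Mathlib

open scoped ENNReal

universe u

/-- A unitary representation of the discrete group `G` on a nonzero complex Hilbert space.
Every unitary representation of `G` is a direct sum of cyclic ones, and a cyclic one acts on a
Hilbert space with a dense subset of cardinality at most `max |G| ℵ₀`, so Hilbert spaces in the
universe of `G` suffice for the supremum of the norms `‖π(f)‖` over all representations `π`. -/
structure UnitaryRep (G : Type u) [Group G] : Type (u + 1) where
  /-- the Hilbert space on which `G` acts -/
  space : Type u
  [normed : NormedAddCommGroup space]
  [inner : InnerProductSpace ℂ space]
  [complete : CompleteSpace space]
  [nontrivial : Nontrivial space]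
  /-- the action, by unitary operators -/
  toHom : G →* unitary (space →L[ℂ] space)

attribute [instance] UnitaryRep.normed UnitaryRep.inner UnitaryRep.complete UnitaryRep.nontrivial

/-- The C⋆-algebra `B(H)` of bounded operators on the Hilbert space `H` of a representation. -/
abbrev UnitaryRep.Op {G : Type u} [Group G] (π : UnitaryRep G) : Type u :=
  π.space →L[ℂ] π.space

/-- The `ℓ^∞`-direct product of the algebras `B(H_π)` over all unitary representations `π` of `G`:
bounded families `(T_π)` with pointwise operations and the norm `sup_π ‖T_π‖`. -/
abbrev UnitaryRepProduct (G : Type u) [Group G] : Type (u + 1) :=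
  lp (fun π : UnitaryRep G => π.Op) ∞

noncomputable instance UnitaryRepProduct.instCStarAlgebra (G : Type u) [Group G] :
    CStarAlgebra (UnitaryRepProduct G) where

/-- The group element `g` acting in all unitary representations at once, `(π(g))_π`. -/
noncomputable def universalUnitary (G : Type u) [Group G] (g : G) : UnitaryRepProduct G :=
  ⟨fun π => (π.toHom g : π.Op), memℓp_infty ⟨1, by
    rintro _ ⟨π, rfl⟩
    exact CStarRing.norm_coe_unitary _ |>.le⟩⟩

/-- The norm closure of the star subalgebra generated by the operators `(π(g))_π`, `g ∈ G`, i.e. of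
the image of the group algebra `ℂ[G]` under the sum of all unitary representations of `G`. -/
noncomputable def fullGroupCStarSubalgebra (G : Type u) [Group G] :
    StarSubalgebra ℂ (UnitaryRepProduct G) :=
  (StarAlgebra.adjoin ℂ (Set.range (universalUnitary G))).topologicalClosure

/-- The full group C⋆-algebra `C*(G)` of the discrete group `G`: the completion of the group algebra
`ℂ[G]` in the norm `‖f‖ = sup_π ‖π(f)‖`, `π` running through the unitary representations of `G`,
realised as a norm-closed algebra of operators. -/
abbrev FullGroupCStarAlgebra (G : Type u) [Group G] : Type (u + 1) :=
  fullGroupCStarSubalgebra G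

noncomputable instance FullGroupCStarAlgebra.instCStarAlgebra (G : Type u) [Group G] :
    CStarAlgebra (FullGroupCStarAlgebra G) :=
  StarSubalgebra.cstarAlgebra (fullGroupCStarSubalgebra G)
    (h_closed := StarSubalgebra.isClosed_topologicalClosure _)

/-- A unital C⋆-algebra is residually finite-dimensional if its representations on
finite-dimensional Hilbert spaces separate its points. -/
def IsResiduallyFiniteDimensional (A : Type*) [CStarAlgebra A] : Prop :=
  ∀ x : A, x ≠ 0 → ∃ (d : ℕ)
    (φ : A →⋆ₐ[ℂ] (EuclideanSpace ℂ (Fin d) →L[ℂ] EuclideanSpace ℂ (Fin d))), φ x ≠ 0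

/-- The relators `x_i ^ (a i) * (x_{i+1} ^ (b i))⁻¹`, `i < m`, in the free group on
`x_0, …, x_m`. -/
def chainRelators {m : ℕ} (a b : Fin m → ℕ) : Set (FreeGroup (Fin (m + 1))) :=
  Set.range fun i : Fin m =>
    FreeGroup.of i.castSucc ^ a i * (FreeGroup.of i.succ ^ b i)⁻¹

/-- The group `⟨x_0, …, x_m | x_i ^ (a i) = x_{i+1} ^ (b i), i < m⟩` with `n = m + 1` generators. -/
abbrev ChainGroup {m : ℕ} (a b : Fin m → ℕ) : Type :=
  PresentedGroup (chainRelators a b)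

open Filter Topology

universe v

/-! A nonzero `c` in `C*(G)` is nonzero in some representation `π`, so it suffices that every `π` is
a limit of finite-dimensional representations, in the sense of `eval_eq_zero_of_approx`:
contractions `J i` that asymptotically preserve norms and intertwine the generators. Two
approximations are composed.

Finite order (`eval_eq_zero_of_finiteDimensional`). Suitable powers `x_i ^ N_i` all equal one
central element, acting as `Z`. On `H ^ M` let `t` be a cyclic shift commuting with the generators,
with `t ^ M = Z ^ (-(Q + 1))` and `M = D (Q + 1)`. If `d_i N_i = D`, the unitaries `x_i t ^ d_i`
still satisfy the relations and have finite order. Constant vectors are moved by `t` only by `O(M ^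
(-1/2))`, so these representations approximate `π` as `Q → ∞`.

Finite dimension (`exists_finiteDimensional_chain`). A unitary of finite order has many
finite-dimensional invariant subspaces. Working along the chain, each generator is kept on such a
subspace and extended to the rest of a larger finite-dimensional space by a root of the unitary that
the relation prescribes; roots of unitaries always exist. -/

/-- Evaluation of an element of the product of all `B(H_π)` at one representation `π`. -/
noncomputable def UnitaryRepProduct.eval {G : Type u} [Group G] (π : UnitaryRep G) :
    UnitaryRepProduct G →⋆ₐ[ℂ] π.Op where
  toFun c := c π
  map_one' := by rw [lp.infty_coeFn_one]; rfl
  map_mul' c d := by rw [lp.infty_coeFn_mul]; rfl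
  map_zero' := rfl
  map_add' _ _ := rfl
  commutes' _ := rfl
  map_star' _ := rfl

theorem UnitaryRepProduct.norm_eval_le {G : Type u} [Group G] (π : UnitaryRep G)
    (c : UnitaryRepProduct G) : ‖UnitaryRepProduct.eval π c‖ ≤ ‖c‖ :=
  lp.norm_apply_le_norm ENNReal.top_ne_zero c π

@[simp]
theorem UnitaryRepProduct.eval_universalUnitary {G : Type u} [Group G] (π : UnitaryRep G) (g : G) :
    UnitaryRepProduct.eval π (universalUnitary G g) = (π.toHom g : π.Op) := rfl

/-! ### Approximation of representations and its effect on `C*(G)`. -/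

section Intertwiner

variable {G : Type u} [Group G] {ι : Type v} (l : Filter ι) (π : UnitaryRep G)
  (ρ : ι → UnitaryRep G) (J : ∀ i, π.space →L[ℂ] (ρ i).space)

open UnitaryRepProduct

/-- The maps `J i` asymptotically intertwine the actions of `c` in `π` and in `ρ i`. -/
def AsymptoticallyIntertwines (c : UnitaryRepProduct G) : Prop :=
  ∀ ξ : π.space, Tendsto (fun i => ‖eval (ρ i) c (J i ξ) - J i (eval π c ξ)‖) l (𝓝 0)

variable {l π ρ J}

namespace AsymptoticallyIntertwines

theorem of_le {c : UnitaryRepProduct G} (f : π.space → ι → ℝ)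
    (hf : ∀ ξ, Tendsto (f ξ) l (𝓝 0))
    (h : ∀ ξ i, ‖eval (ρ i) c (J i ξ) - J i (eval π c ξ)‖ ≤ f ξ i) :
    AsymptoticallyIntertwines l π ρ J c := fun ξ =>
  squeeze_zero (fun _ => norm_nonneg _) (h ξ) (hf ξ)

theorem add {c d : UnitaryRepProduct G} (hc : AsymptoticallyIntertwines l π ρ J c)
    (hd : AsymptoticallyIntertwines l π ρ J d) : AsymptoticallyIntertwines l π ρ J (c + d) := by
  refine of_le _ (fun ξ => by simpa using (hc ξ).add (hd ξ)) fun ξ i => ?_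
  simp only [map_add, add_apply]
  rw [add_sub_add_comm]
  exact norm_add_le _ _

theorem mul {c d : UnitaryRepProduct G} (hc : AsymptoticallyIntertwines l π ρ J c)
    (hd : AsymptoticallyIntertwines l π ρ J d) : AsymptoticallyIntertwines l π ρ J (c * d) := by
  refine of_le (fun ξ i => ‖c‖ * ‖eval (ρ i) d (J i ξ) - J i (eval π d ξ)‖ +
      ‖eval (ρ i) c (J i (eval π d ξ)) - J i (eval π c (eval π d ξ))‖)
    (fun ξ => by simpa using ((hd ξ).const_mul ‖c‖).add (hc (eval π d ξ))) fun ξ i => ?_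
  simp only [map_mul, mul_apply_eq_comp]
  rw [← sub_add_sub_cancel _ (eval (ρ i) c (J i (eval π d ξ))), ← map_sub]
  refine (norm_add_le _ _).trans (add_le_add_left ?_ _)
  exact ((eval (ρ i) c).le_opNorm _).trans
    (mul_le_mul_of_nonneg_right (norm_eval_le _ _) (norm_nonneg _))

theorem algebraMap_scalar (r : ℂ) :
    AsymptoticallyIntertwines l π ρ J (algebraMap ℂ (UnitaryRepProduct G) r) := by
  refine of_le (fun _ _ => 0) (fun _ => tendsto_const_nhds) fun ξ i => ?_
  simp [Algebra.algebraMap_eq_smul_one]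

/-- The error for `g⁻¹` at `ξ` equals the error for `g` at `π(g⁻¹) ξ`, because `ρ i` acts by
isometries. -/
theorem universalUnitary_inv {g : G}
    (hg : AsymptoticallyIntertwines l π ρ J (universalUnitary G g)) :
    AsymptoticallyIntertwines l π ρ J (universalUnitary G g⁻¹) := by
  have hinv (σ : UnitaryRep G) (h : G) (η : σ.space) :
      (σ.toHom h⁻¹ : σ.Op) ((σ.toHom h : σ.Op) η) = η := by
    rw [← mul_apply_eq_comp, ← Submonoid.coe_mul, ← map_mul]; simp
  refine of_le _ (fun ξ => hg ((π.toHom g⁻¹ : π.Op) ξ)) fun ξ i => le_of_eq ?_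
  have hnorm (η : (ρ i).space) :
      ‖((ρ i).toHom g⁻¹ : (ρ i).Op) η‖ = ‖η‖ := Unitary.norm_map _ _
  have hξ : (π.toHom g : π.Op) ((π.toHom g⁻¹ : π.Op) ξ) = ξ := by
    simpa using hinv π g⁻¹ ξ
  simp only [eval_universalUnitary]
  rw [hξ, ← hnorm (_ - J i ξ), map_sub, hinv, norm_sub_rev]

theorem star_universalUnitary {g : G} (hg : AsymptoticallyIntertwines l π ρ J (universalUnitary G g⁻¹)) :
    AsymptoticallyIntertwines l π ρ J (star (universalUnitary G g)) := by
  have : star (universalUnitary G g) = universalUnitary G g⁻¹ := by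
    ext1
    funext σ
    change star (σ.toHom g : σ.Op) = (σ.toHom g⁻¹ : σ.Op)
    rw [map_inv]; rfl
  rwa [this]

theorem universalUnitary_of_closure {s : Set G} (hs : Subgroup.closure s = ⊤)
    (h : ∀ g ∈ s, AsymptoticallyIntertwines l π ρ J (universalUnitary G g)) (g : G) :
    AsymptoticallyIntertwines l π ρ J (universalUnitary G g) := by
  have hg : g ∈ Subgroup.closure s := hs ▸ Subgroup.mem_top g
  induction hg using Subgroup.closure_induction with
  | mem g hg => exact h g hg
  | one =>
    have : universalUnitary G 1 = 1 := by
      ext1; funext σ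
      change (σ.toHom 1 : σ.Op) = _
      rw [map_one, lp.infty_coeFn_one]; rfl
    rw [this, ← map_one (algebraMap ℂ _)]
    exact algebraMap_scalar 1
  | mul x y _ _ hx hy =>
    have : universalUnitary G (x * y) = universalUnitary G x * universalUnitary G y := by
      ext1; funext σ
      change (σ.toHom (x * y) : σ.Op) = _
      rw [map_mul, lp.infty_coeFn_mul]; rfl
    rw [this]
    exact hx.mul hy
  | inv x _ hx => exact hx.universalUnitary_inv

theorem of_mem_fullGroupCStarSubalgebra (hJ : ∀ i ξ, ‖J i ξ‖ ≤ ‖ξ‖)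
    (h : ∀ g, AsymptoticallyIntertwines l π ρ J (universalUnitary G g))
    {c : UnitaryRepProduct G} (hc : c ∈ fullGroupCStarSubalgebra G) :
    AsymptoticallyIntertwines l π ρ J c := by
  have hadj : ∀ d ∈ StarAlgebra.adjoin ℂ (Set.range (universalUnitary G)),
      AsymptoticallyIntertwines l π ρ J d := by
    intro d hd
    rw [← StarSubalgebra.mem_toSubalgebra, StarAlgebra.adjoin_toSubalgebra] at hd
    induction hd using Algebra.adjoin_induction with
    | mem x hx =>
      rcases hx with ⟨g, rfl⟩ | hx
      · exact h g
      · obtain ⟨g, hg⟩ := hx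
        rw [← star_star x, ← hg]
        exact star_universalUnitary (h _)
    | algebraMap r => exact algebraMap_scalar r
    | add x y _ _ hx hy => exact hx.add hy
    | mul x y _ _ hx hy => exact hx.mul hy
  intro ξ
  rw [Metric.tendsto_nhds]
  intro ε hε
  have hc' : c ∈ closure (StarAlgebra.adjoin ℂ (Set.range (universalUnitary G)) :
      Set (UnitaryRepProduct G)) := hc
  -- Replacing `c` by `d` costs at most `2 ‖c - d‖ ‖ξ‖ < ε / 2`, uniformly in `i`; the `+ 1` covers
  -- `ξ = 0`.
  obtain ⟨d, hd, hcd⟩ := Metric.mem_closure_iff.1 hc' (ε / (4 * (‖ξ‖ + 1))) (by positivity)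
  filter_upwards [(Metric.tendsto_nhds.1 (hadj d hd ξ)) (ε / 2) (half_pos hε)] with i hi
  rw [Real.dist_0_eq_abs, abs_norm] at hi ⊢
  rw [dist_eq_norm] at hcd
  have key : eval (ρ i) c (J i ξ) - J i (eval π c ξ) =
      (eval (ρ i) d (J i ξ) - J i (eval π d ξ)) + eval (ρ i) (c - d) (J i ξ)
        - J i (eval π (c - d) ξ) := by
    simp only [map_sub, sub_apply]
    abel
  have b1 : ‖eval (ρ i) (c - d) (J i ξ)‖ ≤ ‖c - d‖ * ‖ξ‖ :=
    ((eval (ρ i) (c - d)).le_opNorm _).trans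
      (mul_le_mul (norm_eval_le _ _) (hJ i ξ) (norm_nonneg _) (norm_nonneg _))
  have b2 : ‖J i (eval π (c - d) ξ)‖ ≤ ‖c - d‖ * ‖ξ‖ :=
    (hJ i _).trans <| ((eval π (c - d)).le_opNorm _).trans
      (mul_le_mul_of_nonneg_right (norm_eval_le _ _) (norm_nonneg _))
  have b3 : ‖c - d‖ * ‖ξ‖ < ε / 4 := by
    have h1 : 0 < ‖ξ‖ + 1 := by positivity
    rw [lt_div_iff₀ (by positivity)] at hcd
    nlinarith [norm_nonneg (c - d)]
  rw [key]
  refine ((norm_sub_le _ _).trans (add_le_add_left (norm_add_le _ _) _)).trans_lt ?_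
  linarith

end AsymptoticallyIntertwines

/-- An element of `C*(G)` killed by representations which approximate `π` on generators
is killed by `π`. -/
theorem eval_eq_zero_of_approx [l.NeBot] {s : Set G} (hs : Subgroup.closure s = ⊤)
    (hJ : ∀ i ξ, ‖J i ξ‖ ≤ ‖ξ‖) (hJ' : ∀ ξ, Tendsto (fun i => ‖J i ξ‖) l (𝓝 ‖ξ‖))
    (h : ∀ g ∈ s, ∀ ξ, Tendsto
      (fun i => ‖((ρ i).toHom g : (ρ i).Op) (J i ξ) - J i ((π.toHom g : π.Op) ξ)‖) l (𝓝 0))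
    {c : UnitaryRepProduct G} (hc : c ∈ fullGroupCStarSubalgebra G)
    (h0 : ∀ i, eval (ρ i) c = 0) : eval π c = 0 := by
  ext ξ
  -- As `ρ i` kills `c`, intertwining says `J i (π(c) ξ) → 0`, while its norm tends to `‖π(c) ξ‖`.
  have := AsymptoticallyIntertwines.of_mem_fullGroupCStarSubalgebra hJ
    (AsymptoticallyIntertwines.universalUnitary_of_closure hs h) hc ξ
  simp only [h0, zero_apply, zero_sub, norm_neg] at this
  simpa using tendsto_nhds_unique (hJ' _) this

end Intertwiner

/-! ### Roots of unitaries and finite-dimensional models of finite-order chains. -/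

section FiniteDimensional

variable {H : Type*} [NormedAddCommGroup H] [InnerProductSpace ℂ H]

/-- A finite-dimensional subspace is contained in a finite-dimensional subspace invariant under
a given isometry of finite order. -/
theorem exists_invariant_finiteDimensional (X : H ≃ₗᵢ[ℂ] H) {n : ℕ} (hn : 0 < n) (hX : X ^ n = 1)
    (F : Submodule ℂ H) [FiniteDimensional ℂ F] :
    ∃ E : Submodule ℂ H, FiniteDimensional ℂ E ∧ F ≤ E ∧ ∀ v ∈ E, X v ∈ E := by
  let f (k : ℕ) : H →ₗ[ℂ] H := ((X ^ k : H ≃ₗᵢ[ℂ] H) : H →ₗ[ℂ] H)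
  refine ⟨⨆ k : Fin n, F.map (f k), inferInstance, ?_, ?_⟩
  · refine le_trans (le_of_eq ?_) (le_iSup (fun k : Fin n => F.map (f k)) ⟨0, hn⟩)
    exact (Submodule.map_id F).symm
  · intro v hv
    have : (⨆ k : Fin n, F.map (f k)) ≤ (⨆ k : Fin n, F.map (f k)).comap (f 1) := by
      refine iSup_le fun k => ?_
      rintro _ ⟨w, hw, rfl⟩
      have hmod : X ^ ((k + 1 : ℕ) % n) = X ^ (k + 1 : ℕ) := by
        conv_rhs => rw [← Nat.mod_add_div (k + 1 : ℕ) n, pow_add, pow_mul, hX, one_pow, mul_one]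
      refine Submodule.mem_iSup_of_mem ⟨(k + 1 : ℕ) % n, Nat.mod_lt _ hn⟩ ⟨w, hw, ?_⟩
      change (X ^ ((k + 1 : ℕ) % n)) w = (X ^ 1) ((X ^ (k : ℕ)) w)
      rw [hmod, pow_succ', pow_one]; rfl
    simpa [f] using this hv

variable {K : Type*} [NormedAddCommGroup K] [InnerProductSpace ℂ K] [FiniteDimensional ℂ K]

theorem ContinuousLinearMap.finite_spectrum (T : K →L[ℂ] K) : (spectrum ℂ T).Finite := by
  have := Module.End.finite_spectrum (K := ℂ) (V := K) ((Module.End.toContinuousLinearMap K).symm T)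
  rwa [AlgEquiv.spectrum_eq] at this

/-- Every unitary operator on a finite-dimensional space has a `b`-th root which commutes with
all self-adjoint operators commuting with it. -/
theorem LinearIsometryEquiv.exists_root (U : K ≃ₗᵢ[ℂ] K) {b : ℕ} (hb : b ≠ 0) :
    ∃ R : K ≃ₗᵢ[ℂ] K, R ^ b = U ∧ ∀ P : K →L[ℂ] K, IsSelfAdjoint P → Commute P (U : K →L[ℂ] K) →
      Commute P (R : K →L[ℂ] K) := by
  have : CompleteSpace K := FiniteDimensional.complete ℂ K
  let u : unitary (K →L[ℂ] K) := Unitary.linearIsometryEquiv.symm U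
  -- The spectrum is finite, so the branch cut of the root does no harm to the functional calculus.
  have hcont (f : ℂ → ℂ) : ContinuousOn f (spectrum ℂ (u : K →L[ℂ] K)) :=
    (ContinuousLinearMap.finite_spectrum _).continuousOn f
  have hn : IsStarNormal (u : K →L[ℂ] K) := inferInstance
  let f : ℂ → ℂ := fun z => z ^ ((b : ℂ)⁻¹)
  have hf (z : ℂ) : f z ^ b = z := Complex.cpow_nat_inv_pow z hb
  let r : K →L[ℂ] K := cfc f (u : K →L[ℂ] K)
  have hr : r ∈ unitary (K →L[ℂ] K) := by
    rw [cfc_unitary_iff f _ hn (hcont f)]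
    intro z hz
    have hz1 : ‖z‖ = 1 := by
      simpa using spectrum.subset_circle_of_unitary u.2 hz
    have h1 : ‖f z‖ = 1 := by
      rw [← pow_eq_one_iff_of_nonneg (norm_nonneg _) hb, ← norm_pow, hf, hz1]
    rw [Complex.star_def, mul_comm, Complex.mul_conj, Complex.normSq_eq_norm_sq, h1]; simp
  have hrb : r ^ b = u := by
    rw [← cfc_pow f b _ (hcont f)]
    simp only [hf]
    exact cfc_id' ℂ _
  refine ⟨Unitary.linearIsometryEquiv ⟨r, hr⟩, ?_, fun P hP hPU => ?_⟩
  · rw [← map_pow]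
    rw [← MulEquiv.eq_symm_apply]
    exact Subtype.ext hrb
  · have h2 : Commute (star (u : K →L[ℂ] K)) P := by
      have := hPU.star_star
      rw [hP.star_eq] at this
      exact this.symm
    exact (Commute.cfc (a := (u : K →L[ℂ] K)) hPU.symm h2 f).symm

/-- If a subspace of a finite-dimensional space is invariant under a unitary, then the unitary
commutes with the orthogonal projection. -/
theorem LinearIsometryEquiv.commute_starProjection (U : K ≃ₗᵢ[ℂ] K) (E : Submodule ℂ K)
    (hE : ∀ e ∈ E, U e ∈ E) : Commute E.starProjection (U : K →L[ℂ] K) := by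
  have hmap : E.map (U.toLinearEquiv : K →ₗ[ℂ] K) = E := by
    refine Submodule.eq_of_le_of_finrank_eq ?_ (LinearEquiv.finrank_map_eq U.toLinearEquiv E)
    rintro _ ⟨e, he, rfl⟩
    exact hE e he
  ext x
  simp only [mul_apply_eq_comp]
  refine Submodule.eq_starProjection_of_mem_orthogonal (hE _ (by simp)) ?_
  change U x - U _ ∈ _
  rw [← map_sub, Submodule.mem_orthogonal]
  intro e he
  rw [← hmap] at he
  obtain ⟨e', he', rfl⟩ := he
  change inner ℂ (U e') (U _) = 0
  rw [U.inner_map_map]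
  exact Submodule.inner_right_of_mem_orthogonal he' (Submodule.sub_starProjection_mem_orthogonal x)

/-- A `b`-th root of a unitary on an invariant subspace extends to a `b`-th root on the whole
finite-dimensional space. -/
theorem LinearIsometryEquiv.exists_root_extending (U : K ≃ₗᵢ[ℂ] K) {b : ℕ} (hb : b ≠ 0)
    (E : Submodule ℂ K) (V : E →ₗᵢ[ℂ] E) (hV : ∀ e : E, ((V ^ b) e : K) = U e) :
    ∃ V' : K ≃ₗᵢ[ℂ] K, V' ^ b = U ∧ ∀ e : E, V' e = V e := by
  obtain ⟨R, hRU, hR⟩ := U.exists_root hb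
  have hP := hR _ (isSelfAdjoint_starProjection E)
    (U.commute_starProjection E fun e he => hV ⟨e, he⟩ ▸ Subtype.prop _)
  have hRorth (x : K) (hx : x ∈ Eᗮ) : R x ∈ Eᗮ := by
    have := congr($(hP.eq) x)
    simp only [mul_apply_eq_comp] at this
    rw [(Submodule.starProjection_apply_eq_zero_iff E).2 hx] at this
    exact (Submodule.starProjection_apply_eq_zero_iff E).1 (this.trans R.map_zero)
  -- `V` on `E` and the root `R` on `Eᗮ`, which `R` preserves because it commutes with the
  -- projection.
  let T : K →ₗ[ℂ] K := E.subtype ∘ₗ V.toLinearMap ∘ₗ (E.orthogonalProjectionOnto : K →ₗ[ℂ] E) +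
    (R : K →ₗ[ℂ] K) ∘ₗ (LinearMap.id - (E.starProjection : K →ₗ[ℂ] K))
  have hT (x : K) : T x = V (E.orthogonalProjectionOnto x) + R (x - E.starProjection x) := rfl
  have hTE (e : E) : T e = V e := by simp [hT]
  have hTo (x : K) (hx : x ∈ Eᗮ) : T x = R x := by
    have h1 : E.starProjection x = 0 := (Submodule.starProjection_apply_eq_zero_iff E).2 hx
    have h2 : E.orthogonalProjectionOnto x = 0 := Subtype.ext h1
    simp [hT, h1, h2]
  have hnorm (x : K) : ‖T x‖ = ‖x‖ := by
    have ho : x - E.starProjection x ∈ Eᗮ := Submodule.sub_starProjection_mem_orthogonal x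
    rw [← sq_eq_sq₀ (norm_nonneg _) (norm_nonneg _)]
    have h1 := norm_add_sq_eq_norm_sq_add_norm_sq_of_inner_eq_zero
      (V (E.orthogonalProjectionOnto x) : K) (R (x - E.starProjection x))
      (Submodule.inner_right_of_mem_orthogonal (Subtype.prop _) (hRorth _ ho))
    have h2 := norm_add_sq_eq_norm_sq_add_norm_sq_of_inner_eq_zero
      (E.starProjection x) (x - E.starProjection x)
      (Submodule.inner_right_of_mem_orthogonal (by simp) ho)
    rw [add_sub_cancel] at h2
    have h3 : ‖(V (E.orthogonalProjectionOnto x) : K)‖ = ‖E.starProjection x‖ := V.norm_map _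
    rw [hT, sq, h1, sq, h2, R.norm_map, h3]
  let V' : K ≃ₗᵢ[ℂ] K := LinearIsometry.toLinearIsometryEquiv ⟨T, hnorm⟩ rfl
  have hV' (x : K) : V' x = T x := rfl
  have hpowE (k : ℕ) (e : E) : (V' ^ k) e = (V ^ k) e := by
    induction k generalizing e with
    | zero => rfl
    | succ k ih =>
      rw [pow_succ, pow_succ]
      change (V' ^ k) (V' e) = (V ^ k) (V e)
      rw [← ih, hV', hTE]
  have hpowo (k : ℕ) (x : K) (hx : x ∈ Eᗮ) : (V' ^ k) x = (R ^ k) x := by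
    induction k generalizing x with
    | zero => rfl
    | succ k ih =>
      rw [pow_succ, pow_succ]
      change (V' ^ k) (V' x) = (R ^ k) (R x)
      rw [hV', hTo x hx, ih _ (hRorth x hx)]
  refine ⟨V', ?_, hTE⟩
  ext x
  have hx : x = E.orthogonalProjectionOnto x + (x - E.starProjection x) := by
    change x = E.starProjection x + _
    abel
  rw [hx, map_add, map_add, hpowE, hV, hpowo _ _ (Submodule.sub_starProjection_mem_orthogonal x),
    hRU]

/-- Finite-order unitaries satisfying the chain relations can be replaced, without changing them on
a given finite-dimensional subspace, by unitaries of a larger finite-dimensional subspace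
satisfying these relations. -/
theorem exists_finiteDimensional_chain (X : ℕ → H ≃ₗᵢ[ℂ] H) (a b n : ℕ → ℕ) (m : ℕ)
    (hb : ∀ i < m, b i ≠ 0) (hn : ∀ i ≤ m, 0 < n i) (hX : ∀ i ≤ m, X i ^ n i = 1)
    (hrel : ∀ i < m, X i ^ a i = X (i + 1) ^ b i)
    (F : Submodule ℂ H) [FiniteDimensional ℂ F] :
    ∃ (K : Submodule ℂ H) (X' : ℕ → K ≃ₗᵢ[ℂ] K), FiniteDimensional ℂ K ∧ F ≤ K ∧
      (∀ i < m, X' i ^ a i = X' (i + 1) ^ b i) ∧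
      ∀ i ≤ m, ∀ k : K, (k : H) ∈ F → (X' i k : H) = X i k := by
  induction m generalizing F with
  | zero =>
    obtain ⟨E, hfd, hFE, hE⟩ :=
      exists_invariant_finiteDimensional (X 0) (hn 0 le_rfl) (hX 0 le_rfl) F
    let V : E →ₗᵢ[ℂ] E := ⟨(X 0 : H →ₗ[ℂ] H).restrict hE, fun x => (X 0).norm_map x⟩
    refine ⟨E, fun _ => V.toLinearIsometryEquiv rfl, hfd, hFE, by simp, ?_⟩
    rintro i hi k -
    obtain rfl : i = 0 := by lia
    rfl
  | succ m ih =>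
    obtain ⟨E, hEfd, hFE, hE⟩ :=
      exists_invariant_finiteDimensional (X (m + 1)) (hn _ le_rfl) (hX _ le_rfl) F
    -- `X' m` will agree with `X m` only on `E'`; invariance of `E'` under `X m` carries the
    -- agreement over to powers.
    obtain ⟨E', hEfd', hEE', hE'⟩ :=
      exists_invariant_finiteDimensional (X m) (hn m (by lia)) (hX m (by lia)) E
    obtain ⟨K, X', hK, hE'K, hX', hagree⟩ := ih (fun i hi => hb i (by lia))
      (fun i hi => hn i (by lia)) (fun i hi => hX i (by lia)) (fun i hi => hrel i (by lia)) E'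
    let EK : Submodule ℂ K := E.comap K.subtype
    have hEK (e : EK) : X (m + 1) (e : K) ∈ E := hE _ e.2
    let V : EK →ₗᵢ[ℂ] EK :=
      { toFun e := ⟨⟨X (m + 1) (e : K), hE'K (hEE' (hEK e))⟩, hEK e⟩
        map_add' x y := by ext; simp
        map_smul' c x := by ext; simp
        norm_map' x := (X (m + 1)).norm_map _ }
    have hVpow (k : ℕ) (e : EK) : (((V ^ k) e : K) : H) = (X (m + 1) ^ k) (e : K) := by
      induction k generalizing e with
      | zero => rfl
      | succ k ih =>
        rw [pow_succ, pow_succ]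
        exact ih (V e)
    have hXpow (j : ℕ) (k : K) (hk : (k : H) ∈ E') :
        ((X' m ^ j) k : H) = (X m ^ j) k ∧ ((X' m ^ j) k : H) ∈ E' := by
      induction j generalizing k with
      | zero => exact ⟨rfl, hk⟩
      | succ j ih =>
        rw [pow_succ, pow_succ]
        have h1 := hagree m le_rfl k hk
        have h2 := ih (X' m k) (h1 ▸ hE' _ hk)
        rw [h1] at h2
        exact h2
    -- On `E` the restriction of `X (m + 1)` is already a `b m`-th root of `X' m ^ a m`, by the
    -- relation in `H`.
    obtain ⟨V', hV'pow, hV'⟩ := (X' m ^ a m).exists_root_extending (hb m (by lia)) EK V fun e => by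
      ext
      rw [hVpow, (hXpow _ e (hEE' e.2)).1, hrel m (by lia)]
    refine ⟨K, Function.update X' (m + 1) V', hK, hFE.trans (hEE'.trans hE'K), ?_, ?_⟩
    · intro i hi
      rw [Function.update_of_ne (by lia)]
      rcases Nat.lt_succ_iff_lt_or_eq.1 hi with h | rfl
      · rw [Function.update_of_ne (by lia), hX' i h]
      · rw [Function.update_self, hV'pow]
    · intro i hi k hk
      rcases Nat.le_succ_iff.1 hi with h | rfl
      · rw [Function.update_of_ne (by lia)]
        exact hagree i h k (hEE' (hFE hk))
      · rw [Function.update_self]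
        exact congr(($(hV' ⟨k, hFE hk⟩) : H))

end FiniteDimensional

/-! ### Twisted cyclic shifts: prescribed `M`-th power, almost fixing constant vectors. -/

section TwistedShift

variable {H : Type*} [NormedAddCommGroup H] [InnerProductSpace ℂ H]

/-- The diagonal action of a unitary of `H` on `H ^ M`. -/
noncomputable def LinearIsometryEquiv.amplify (M : ℕ) [NeZero M] :
    (H ≃ₗᵢ[ℂ] H) →* (PiLp 2 (fun _ : ZMod M => H) ≃ₗᵢ[ℂ] PiLp 2 (fun _ : ZMod M => H)) where
  toFun X := .piLpCongrRight 2 fun _ => X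
  map_one' := rfl
  map_mul' _ _ := rfl

/-- The cyclic shift of `H ^ M`, twisted by `W` at the place where it wraps around. -/
noncomputable def twistedShift (W : H ≃ₗᵢ[ℂ] H) (M : ℕ) [NeZero M] :
    PiLp 2 (fun _ : ZMod M => H) ≃ₗᵢ[ℂ] PiLp 2 (fun _ : ZMod M => H) :=
  (LinearIsometryEquiv.piLpCongrLeft 2 ℂ H (Equiv.addRight (1 : ZMod M))).trans
    (.piLpCongrRight 2 fun k => if k = 0 then W else 1)

/-- The embedding of `H` into `H ^ M` by constant vectors, normalized to be isometric. -/
noncomputable def constantEmbedding (M : ℕ) [NeZero M] :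
    H →ₗᵢ[ℂ] PiLp 2 (fun _ : ZMod M => H) where
  toFun v := WithLp.toLp 2 fun _ => ((√M : ℝ)⁻¹ : ℂ) • v
  map_add' _ _ := by ext; simp
  map_smul' _ _ := by ext; exact smul_comm _ _ _
  norm_map' v := by
    have hM : (0 : ℝ) < M := Nat.cast_pos.2 (NeZero.pos M)
    rw [← sq_eq_sq₀ (norm_nonneg _) (norm_nonneg _)]
    simp [PiLp.norm_sq_eq_of_L2, norm_smul, mul_pow]
    rw [mul_inv_cancel_left₀ hM.ne']

variable (W : H ≃ₗᵢ[ℂ] H) (M : ℕ) [NeZero M]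

theorem twistedShift_apply (f : PiLp 2 (fun _ : ZMod M => H)) (k : ZMod M) :
    twistedShift W M f k = (if k = 0 then W else 1) (f (k - 1)) := by
  simp [twistedShift, LinearIsometryEquiv.piLpCongrLeft_apply, sub_eq_add_neg]

/-- Going back `j` steps from `k` meets coordinate `0` at the `i < j` with `i = k` in `ZMod M`; each
meeting contributes one factor `W`. -/
theorem twistedShift_pow_apply (j : ℕ) (f : PiLp 2 (fun _ : ZMod M => H)) (k : ZMod M) :
    (twistedShift W M ^ j) f k =
      (W ^ ((Finset.range j).filter fun i : ℕ => (i : ZMod M) = k).card) (f (k - j)) := by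
  induction j generalizing f with
  | zero => simp
  | succ j ih =>
    rw [pow_succ]
    change (twistedShift W M ^ j) (twistedShift W M f) k = _
    rw [ih, twistedShift_apply, Finset.range_add_one, Finset.filter_insert]
    have h1 : k - (j + 1 : ℕ) = k - j - 1 := by push_cast; ring
    rw [h1]
    by_cases h : (j : ZMod M) = k
    · rw [if_pos (by rw [h, sub_self]), if_pos h, Finset.card_insert_of_notMem (by simp), pow_succ]
      rfl
    · rw [if_neg (by rwa [sub_eq_zero, eq_comm]), if_neg h]
      rfl

theorem twistedShift_pow_self : twistedShift W M ^ M = LinearIsometryEquiv.amplify M W := by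
  ext f k
  have : ((Finset.range M).filter fun i : ℕ => (i : ZMod M) = k) = {k.val} := by
    ext i
    simp only [Finset.mem_filter, Finset.mem_range, Finset.mem_singleton]
    constructor
    · rintro ⟨hi, rfl⟩
      exact (ZMod.val_cast_of_lt hi).symm
    · rintro rfl
      exact ⟨ZMod.val_lt k, ZMod.natCast_zmod_val k⟩
  rw [twistedShift_pow_apply, this]
  simp only [Finset.card_singleton, pow_one, CharP.cast_eq_zero, sub_zero]
  rfl

theorem commute_amplify_twistedShift {X W : H ≃ₗᵢ[ℂ] H} (h : Commute X W) :
    Commute (LinearIsometryEquiv.amplify M X) (twistedShift W M) := by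
  ext f k
  change X (twistedShift W M f k) = twistedShift W M (LinearIsometryEquiv.amplify M X f) k
  rw [twistedShift_apply, twistedShift_apply]
  split_ifs
  · exact congr($(h.eq) (f (k - 1)))
  · rfl

/-- A constant vector changes only at coordinate `0`, where the twist acts. -/
theorem norm_twistedShift_constantEmbedding_sub_le (v : H) :
    ‖twistedShift W M (constantEmbedding M v) - constantEmbedding M v‖ ≤ 2 * ‖v‖ * (√M)⁻¹ := by
  have : twistedShift W M (constantEmbedding M v) - constantEmbedding M v =
      PiLp.single 2 (0 : ZMod M) (((√M : ℝ)⁻¹ : ℂ) • (W v - v)) := by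
    ext k
    rw [PiLp.sub_apply, twistedShift_apply]
    by_cases hk : k = 0
    · subst hk; simp [constantEmbedding, smul_sub]
    · simp [constantEmbedding, hk]
  rw [this, PiLp.norm_single, norm_smul, mul_comm]
  refine mul_le_mul ?_ (by simp [abs_of_nonneg]) (norm_nonneg _) (by positivity)
  refine (norm_sub_le _ _).trans ?_
  rw [W.norm_map, two_mul]

theorem norm_twistedShift_pow_constantEmbedding_sub_le (d : ℕ) (v : H) :
    ‖(twistedShift W M ^ d) (constantEmbedding M v) - constantEmbedding M v‖ ≤
      d * (2 * ‖v‖ * (√M)⁻¹) := by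
  induction d with
  | zero => simp
  | succ d ih =>
    rw [pow_succ']
    change ‖twistedShift W M ((twistedShift W M ^ d) (constantEmbedding M v)) - _‖ ≤ _
    rw [← sub_add_sub_cancel _ (twistedShift W M (constantEmbedding M v)), ← map_sub]
    refine (norm_add_le _ _).trans ?_
    rw [LinearIsometryEquiv.norm_map]
    have := norm_twistedShift_constantEmbedding_sub_le W M v
    push_cast
    linarith

end TwistedShift

/-! ### Chain groups: reduction to finite order, then to finite dimension. -/

section ChainGroup

variable {m : ℕ} {a b : Fin m → ℕ}

/-- The representation of the chain group given by unitaries satisfying its relations. -/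
noncomputable def ChainGroup.rep {K : Type} [NormedAddCommGroup K] [InnerProductSpace ℂ K]
    [CompleteSpace K] [Nontrivial K] (Y : Fin (m + 1) → K ≃ₗᵢ[ℂ] K)
    (hY : ∀ i, Y i.castSucc ^ a i = Y i.succ ^ b i) : UnitaryRep (ChainGroup a b) where
  space := K
  toHom := (Unitary.linearIsometryEquiv (𝕜 := ℂ) (H := K)).symm.toMonoidHom.comp
    (PresentedGroup.toGroup (f := Y) (by rintro _ ⟨i, rfl⟩; simp [hY]))

theorem ChainGroup.rep_of {K : Type} [NormedAddCommGroup K] [InnerProductSpace ℂ K]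
    [CompleteSpace K] [Nontrivial K] (Y : Fin (m + 1) → K ≃ₗᵢ[ℂ] K)
    (hY : ∀ i, Y i.castSucc ^ a i = Y i.succ ^ b i) (i : Fin (m + 1)) (v : K) :
    ((ChainGroup.rep Y hY).toHom (PresentedGroup.of i) : (ChainGroup.rep Y hY).Op) v = Y i v := by
  have h : ∀ r ∈ chainRelators a b, FreeGroup.lift Y r = 1 := by
    rintro _ ⟨i, rfl⟩; simp [hY]
  exact congr($(PresentedGroup.toGroup.of h (x := i)) v)

/-- The unitary by which a generator of the chain group acts. -/
noncomputable def UnitaryRep.gen (π : UnitaryRep (ChainGroup a b)) (i : Fin (m + 1)) :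
    π.space ≃ₗᵢ[ℂ] π.space :=
  Unitary.linearIsometryEquiv (π.toHom (PresentedGroup.of i))

theorem UnitaryRep.gen_rel (π : UnitaryRep (ChainGroup a b)) (i : Fin m) :
    π.gen i.castSucc ^ a i = π.gen i.succ ^ b i := by
  have : (PresentedGroup.of i.castSucc : ChainGroup a b) ^ a i = PresentedGroup.of i.succ ^ b i := by
    rw [← mul_inv_eq_one]
    exact PresentedGroup.one_of_mem (rels := chainRelators a b) ⟨i, rfl⟩
  rw [gen, gen, ← map_pow, ← map_pow, ← map_pow, ← map_pow, this]

/-- An element of the `C*`-algebra of a chain group killed by representations whose generators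
approximate those of `π` is killed by `π`. -/
theorem ChainGroup.eval_eq_zero_of_approx {ι : Type*} {l : Filter ι} [l.NeBot]
    {π : UnitaryRep (ChainGroup a b)} {K : ι → Type} [∀ s, NormedAddCommGroup (K s)]
    [∀ s, InnerProductSpace ℂ (K s)] [∀ s, CompleteSpace (K s)] [∀ s, Nontrivial (K s)]
    (Y : ∀ s, Fin (m + 1) → K s ≃ₗᵢ[ℂ] K s)
    (hY : ∀ s i, Y s (Fin.castSucc i) ^ a i = Y s (Fin.succ i) ^ b i)
    (J : ∀ s, π.space →L[ℂ] K s) (hJ : ∀ s v, ‖J s v‖ ≤ ‖v‖)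
    (hJ' : ∀ v, Tendsto (fun s => ‖J s v‖) l (𝓝 ‖v‖))
    (h : ∀ i v, Tendsto (fun s => ‖Y s i (J s v) - J s (π.gen i v)‖) l (𝓝 0))
    {c : UnitaryRepProduct (ChainGroup a b)} (hc : c ∈ fullGroupCStarSubalgebra (ChainGroup a b))
    (h0 : ∀ s, UnitaryRepProduct.eval (ChainGroup.rep (Y s) (hY s)) c = 0) :
    UnitaryRepProduct.eval π c = 0 := by
  refine _root_.eval_eq_zero_of_approx (l := l) (ρ := fun s => ChainGroup.rep (Y s) (hY s))
    (J := J) (PresentedGroup.closure_range_of _) hJ hJ' ?_ hc h0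
  rintro _ ⟨i, rfl⟩ v
  refine (h i v).congr fun s => ?_
  rw [← ChainGroup.rep_of (Y s) (hY s)]
  rfl

/-- Elements of the `C*`-algebra of a chain group which are killed by all finite-dimensional
representations are killed by all representations in which the generators have finite order. -/
theorem eval_eq_zero_of_finite_order (hb : ∀ i, b i ≠ 0)
    {c : UnitaryRepProduct (ChainGroup a b)} (hc : c ∈ fullGroupCStarSubalgebra (ChainGroup a b))
    (h0 : ∀ ρ : UnitaryRep (ChainGroup a b), FiniteDimensional ℂ ρ.space →
      UnitaryRepProduct.eval ρ c = 0)
    (π : UnitaryRep (ChainGroup a b)) (n : Fin (m + 1) → ℕ) (hn : ∀ i, 0 < n i)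
    (hπ : ∀ i, π.gen i ^ n i = 1) : UnitaryRepProduct.eval π c = 0 := by
  classical
  -- Put into every `K s` to keep it nontrivial.
  obtain ⟨ξ₀, hξ₀⟩ := exists_ne (0 : π.space)
  have key (s : Finset π.space) : ∃ (K : Submodule ℂ π.space) (Y : Fin (m + 1) → K ≃ₗᵢ[ℂ] K),
      FiniteDimensional ℂ K ∧ (∀ v ∈ insert ξ₀ s, v ∈ K) ∧
      (∀ i, Y i.castSucc ^ a i = Y i.succ ^ b i) ∧
      ∀ i, ∀ k : K, (k : π.space) ∈ s → (Y i k : π.space) = π.gen i k := by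
    have hfd : FiniteDimensional ℂ (Submodule.span ℂ ((insert ξ₀ s : Finset π.space) : Set π.space)) :=
      FiniteDimensional.span_finset ℂ _
    obtain ⟨K, X', hK, hF, hrel, hag⟩ := exists_finiteDimensional_chain
      (fun i => if h : i < m + 1 then π.gen ⟨i, h⟩ else 1)
      (fun i => if h : i < m then a ⟨i, h⟩ else 0) (fun i => if h : i < m then b ⟨i, h⟩ else 0)
      (fun i => if h : i < m + 1 then n ⟨i, h⟩ else 0) m
      (fun i hi => by simp [hi, hb]) (fun i hi => by simp [Nat.lt_succ_of_le hi, hn])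
      (fun i hi => by simp [Nat.lt_succ_of_le hi, hπ])
      (fun i hi => by
        have := π.gen_rel ⟨i, hi⟩
        simpa [hi, Nat.lt_succ_of_lt hi] using this)
      (Submodule.span ℂ ((insert ξ₀ s : Finset π.space) : Set π.space))
    refine ⟨K, fun i => X' i, hK, fun v hv => hF (Submodule.subset_span hv), fun i => ?_,
      fun i k hk => ?_⟩
    · simpa using hrel i i.2
    · have := hag i (Nat.lt_succ_iff.1 i.2) k
        (Submodule.subset_span (Finset.mem_coe.2 (Finset.mem_insert_of_mem hk)))
      rwa [dif_pos i.2] at this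
  choose K Y hK hsK hrel hag using key
  have hne (s) : Nontrivial (K s) :=
    ⟨⟨ξ₀, hsK s _ (Finset.mem_insert_self _ _)⟩, 0, fun h => hξ₀ congr(($h : π.space))⟩
  have hcomplete (s) : CompleteSpace (K s) := FiniteDimensional.complete ℂ (K s)
  let J (s) : π.space →L[ℂ] K s := (K s).orthogonalProjectionOnto
  have hJ (s) (v : π.space) (hv : v ∈ K s) : J s v = ⟨v, hv⟩ :=
    (K s).orthogonalProjectionOnto_mem_subspace_eq_self ⟨v, hv⟩
  -- Along the finite subsets `s` the approximation is eventually exact: once `s` contains `v` and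
  -- its image under the generator.
  have hev (v : π.space) : ∀ᶠ s : Finset π.space in atTop, v ∈ s :=
    (eventually_ge_atTop {v}).mono fun s hs => Finset.singleton_subset_iff.1 hs
  have hmem {s : Finset π.space} {v : π.space} (hv : v ∈ s) : v ∈ K s :=
    hsK s v (Finset.mem_insert_of_mem hv)
  refine ChainGroup.eval_eq_zero_of_approx (l := atTop) Y hrel J
    (fun s v => (K s).norm_orthogonalProjectionOnto_apply_le v)
    (fun v => ?_) (fun i v => ?_) hc fun s => h0 _ (hK s)
  · refine tendsto_const_nhds.congr' ?_
    filter_upwards [hev v] with s hs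
    rw [hJ s v (hmem hs)]
    rfl
  · refine tendsto_const_nhds.congr' ?_
    filter_upwards [hev v, hev (π.gen i v)] with s hs hs'
    rw [hJ s v (hmem hs), hJ s _ (hmem hs')]
    have : Y s i ⟨v, hmem hs⟩ = ⟨π.gen i v, hmem hs'⟩ := Subtype.ext (hag s i ⟨v, _⟩ hs)
    rw [this, sub_self, norm_zero]

/-- The generators of a chain group have a common power, with exponents proportional to the inverses
of weights which are compatible with the relations. -/
theorem exists_exponents (a b : Fin m → ℕ) (ha : ∀ i, a i ≠ 0) (hb : ∀ i, b i ≠ 0) :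
    ∃ (N d : Fin (m + 1) → ℕ) (p : Fin m → ℕ) (D : ℕ), D ≠ 0 ∧ (∀ i, 0 < N i) ∧
      (∀ i, d i * N i = D) ∧ (∀ i, N i.castSucc = a i * p i ∧ N i.succ = b i * p i) ∧
      ∀ i, d i.castSucc * a i = d i.succ * b i := by
  -- Relations before `i` contribute `u`, the others `v`. With `N = f b a` and `d = f a b`, every `d
  -- i * N i` is `∏ a j * b j`, and passing relation `i` changes a single factor.
  let f (u v : Fin m → ℕ) (i : Fin (m + 1)) : ℕ := ∏ j, if j.castSucc < i then u j else v j
  have hf (u v i) : f u v (Fin.castSucc i) =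
      v i * ∏ j ∈ Finset.univ.erase i, if j < i then u j else v j := by
    change ∏ j, _ = _
    rw [← Finset.mul_prod_erase _ _ (Finset.mem_univ i)]
    simp
  have hf' (u v i) : f u v (Fin.succ i) =
      u i * ∏ j ∈ Finset.univ.erase i, if j < i then u j else v j := by
    change ∏ j, _ = _
    rw [← Finset.mul_prod_erase _ _ (Finset.mem_univ i)]
    congr 1
    · simp
    · refine Finset.prod_congr rfl fun j hj => ?_
      have : j.castSucc < i.succ ↔ j < i := by
        have := Finset.ne_of_mem_erase hj
        rw [Fin.lt_def, Fin.lt_def, Fin.val_castSucc, Fin.val_succ]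
        lia
      simp only [this]
  refine ⟨f b a, f a b, _, ∏ j, a j * b j, ?_, fun i => Finset.prod_pos fun j _ => ?_, fun i => ?_,
    fun i => ⟨hf b a i, hf' b a i⟩, fun i => ?_⟩
  · exact Finset.prod_ne_zero_iff.2 fun j _ => mul_ne_zero (ha j) (hb j)
  · split_ifs
    · exact Nat.pos_of_ne_zero (hb j)
    · exact Nat.pos_of_ne_zero (ha j)
  · rw [← Finset.prod_mul_distrib]
    refine Finset.prod_congr rfl fun j _ => ?_
    split_ifs
    · rfl
    · exact mul_comm _ _
  · rw [hf, hf']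
    ring

theorem eval_eq_zero_of_finiteDimensional (ha : ∀ i, a i ≠ 0) (hb : ∀ i, b i ≠ 0)
    {c : UnitaryRepProduct (ChainGroup a b)} (hc : c ∈ fullGroupCStarSubalgebra (ChainGroup a b))
    (h0 : ∀ ρ : UnitaryRep (ChainGroup a b), FiniteDimensional ℂ ρ.space →
      UnitaryRepProduct.eval ρ c = 0)
    (π : UnitaryRep (ChainGroup a b)) : UnitaryRepProduct.eval π c = 0 := by
  obtain ⟨N, d, p, D, hD, hN, hdN, hp, hd⟩ := exists_exponents a b ha hb
  have hZ (i : Fin (m + 1)) : π.gen i ^ N i = π.gen 0 ^ N 0 := by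
    induction i using Fin.induction with
    | zero => rfl
    | succ i ih => rw [← ih, (hp i).1, (hp i).2, pow_mul, pow_mul, π.gen_rel]
  let Z := π.gen 0 ^ N 0
  have hcomm (i) : Commute (π.gen i) Z := by
    rw [← show _ = Z from hZ i]
    exact Commute.self_pow _ _
  -- Chosen so that `t ^ (d i * N i * (Q + 1)) = t ^ M`, which `W` makes cancel `Z ^ (Q + 1)`.
  let M (Q : ℕ) : ℕ := D * (Q + 1)
  have hM (Q : ℕ) : NeZero (M Q) := ⟨mul_ne_zero hD (Nat.succ_ne_zero Q)⟩
  let W (Q : ℕ) := (Z ^ (Q + 1))⁻¹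
  let t (Q : ℕ) := twistedShift (W Q) (M Q)
  let A (Q : ℕ) := LinearIsometryEquiv.amplify (H := π.space) (M Q)
  let Y (Q : ℕ) (i : Fin (m + 1)) := A Q (π.gen i) * t Q ^ d i
  have hAt (Q i) : Commute (A Q (π.gen i)) (t Q) :=
    commute_amplify_twistedShift _ ((hcomm i).pow_right _).inv_right
  have hYpow (Q i k) : Y Q i ^ k = A Q (π.gen i ^ k) * t Q ^ (d i * k) := by
    rw [((hAt Q i).pow_right _).mul_pow, map_pow, pow_mul]
  have hrel (Q i) : Y Q (Fin.castSucc i) ^ a i = Y Q (Fin.succ i) ^ b i := by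
    rw [hYpow, hYpow, π.gen_rel, hd]
  have hfin (Q i) : Y Q i ^ (N i * (Q + 1)) = 1 := by
    rw [hYpow, ← mul_assoc, hdN, pow_mul, hZ i]
    change A Q (Z ^ (Q + 1)) * twistedShift (W Q) (M Q) ^ M Q = 1
    rw [twistedShift_pow_self, ← map_mul, mul_inv_cancel, map_one]
  have hlim : Tendsto (fun Q => (√(M Q : ℝ))⁻¹) atTop (𝓝 0) := by
    refine (Real.tendsto_sqrt_atTop.comp (tendsto_natCast_atTop_atTop.comp ?_)).inv_tendsto_atTop
    exact tendsto_atTop_mono (fun Q => (Nat.le_succ Q).trans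
      (Nat.le_mul_of_pos_left _ (Nat.pos_of_ne_zero hD))) tendsto_id
  have hne (Q : ℕ) : Nontrivial (PiLp 2 fun _ : ZMod (M Q) => π.space) :=
    (constantEmbedding (H := π.space) (M Q)).injective.nontrivial
  refine ChainGroup.eval_eq_zero_of_approx (l := atTop) Y hrel
    (fun Q => (constantEmbedding (M Q)).toContinuousLinearMap)
    (fun Q v => ((constantEmbedding (M Q)).norm_map v).le)
    (fun v => ?_) (fun i v => ?_) hc fun Q => ?_
  · exact tendsto_const_nhds.congr fun Q => ((constantEmbedding (M Q)).norm_map v).symm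
  · refine squeeze_zero (fun _ => norm_nonneg _) (fun Q => ?_)
      (g := fun Q => d i * (2 * ‖v‖ * (√(M Q : ℝ))⁻¹)) ?_
    -- The isometry `A Q (π.gen i)` factors out of the difference, leaving only the displacement by
    -- `t ^ d i`.
    · refine le_trans (le_of_eq ?_)
        (norm_twistedShift_pow_constantEmbedding_sub_le (W Q) (M Q) (d i) v)
      rw [← (A Q (π.gen i)).norm_map (_ - constantEmbedding (M Q) v), map_sub]
      have : A Q (π.gen i) (constantEmbedding (M Q) v) = constantEmbedding (M Q) (π.gen i v) := by
        ext k
        exact (π.gen i).map_smul _ _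
      rw [this]
      rfl
    · simpa using (hlim.const_mul (2 * ‖v‖)).const_mul (d i : ℝ)
  · refine eval_eq_zero_of_finite_order hb hc h0 _ (fun i => N i * (Q + 1))
      (fun i => Nat.mul_pos (hN i) Q.succ_pos) fun i => ?_
    have : (ChainGroup.rep (Y Q) (hrel Q)).gen i = Y Q i := by
      ext1 v
      exact ChainGroup.rep_of (Y Q) (hrel Q) i v
    rw [this]
    exact hfin Q i

end ChainGroup

theorem mainTheorem8 {m : ℕ} (a b : Fin m → ℕ) (ha : ∀ i, 2 ≤ a i) (hb : ∀ i, 2 ≤ b i) :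
    IsResiduallyFiniteDimensional (FullGroupCStarAlgebra (ChainGroup a b)) := by
  intro c hc
  have hc0 : (c : UnitaryRepProduct (ChainGroup a b)) ≠ 0 := fun h => hc (Subtype.ext h)
  obtain ⟨π, hπ⟩ : ∃ π, UnitaryRepProduct.eval π (c : UnitaryRepProduct (ChainGroup a b)) ≠ 0 := by
    by_contra! h
    exact hc0 (lp.ext (funext h))
  obtain ⟨ρ, hfd, hρ⟩ : ∃ ρ : UnitaryRep (ChainGroup a b), FiniteDimensional ℂ ρ.space ∧
      UnitaryRepProduct.eval ρ (c : UnitaryRepProduct (ChainGroup a b)) ≠ 0 := by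
    by_contra! h
    exact hπ (eval_eq_zero_of_finiteDimensional (fun i => by have := ha i; lia)
      (fun i => by have := hb i; lia) c.2 h π)
  let e := (stdOrthonormalBasis ℂ ρ.space).repr.conjStarAlgEquiv
  refine ⟨Module.finrank ℂ ρ.space, ((e : ρ.Op →⋆ₐ[ℂ] _).comp (UnitaryRepProduct.eval ρ)).comp
    (fullGroupCStarSubalgebra (ChainGroup a b)).subtype, ?_⟩
  change e (UnitaryRepProduct.eval ρ c) ≠ 0
  simpa using hρ
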